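/- For $\xi\in\mathbb{R}^{2\times 2}$ let $0\le\lambda_1(\xi)\le\lambda_2(\xi)$ be its singular values. A function $f:\mathbb{R}^{2\times2}\to\mathbb{R}\cup\{+\infty\}$ is rank one convex if $f(tA+(1-t)B)\le t f(A)+(1-t)f(B)$ for all $t\in[0,1]$ and all $A,B$ with $\operatorname{rank}(A-B)\le 1$ (with $0\cdot\infty=0$). The rank one convex hull $\operatorname{Rco}E$ of $E\subseteq\mathbb{R}^{2\times2}$ is the set of $\xi$ such that $f(\xi)\le 0$ for every rank one convex $f:\mathbb{R}^{2\times2}\to\mathbb{R}\cup\{+\infty\}$ with $f\le 0$ on $E$. Sets $E\subseteq K(E)\subseteq\mathbb{R}^{2\times2}$ have the approximation property if there are closed sets $E_\delta$ and $K(E_\delta)$, $\delta>0$, satisfying (1)--(3): (1) $E_\delta\subseteq K(E_\delta)\subseteq\operatorname{int}K(E)$ for every $\delta$; (2) for every $\varepsilon>0$ there is $\delta_0>0$ such that $\operatorname{dist}(\eta,E)\le\varepsilon$ for all $\delta\in[0,\delta_0]$ and all $\eta\in E_\delta$ (Euclidean distance on $\mathbb{R}^{2\times2}$; a set $E_0$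 is also understood to be given here); (3) if $\eta\in\operatorname{int}K(E)$, then $\eta\in K(E_\delta)$ for every sufficiently small $\delta>0$. Proposition. Let $K\subset\{(x,y)\in\mathbb{R}^2:0\le x\le y\}$ be a non-empty compact set with $a_0:=\min_{(a,b)\in K}a>0$, let $E=\{\xi\in\mathbb{R}^{2\times2}:(\lambda_1(\xi),\lambda_2(\xi))\in K\}$, and for $0\le\delta\le a_0/2$ let $$E_\delta=\bigcup_{(a,b)\in K}\{\xi\in\mathbb{R}^{2\times2}:(\lambda_1(\xi),\lambda_2(\xi))=(a-\delta,b-\delta)\}.$$ Then $E$ and $\operatorname{Rco}E$ have the approximation property. More precisely, the sets $E_\delta$ and $K(E_\delta)=\operatorname{Rco}E_\delta$ are closed and satisfy (1) (with $K(E)=\operatorname{Rco}E$) for every $0<\delta\le a_0/2$, and they satisfy (2) and (3). -/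

import Mathlib

open Set Filter Topology

/-- The space of real 2 by 2 matrices. -/
abbrev Mat2 : Type := Matrix (Fin 2) (Fin 2) ℝ

/-- The larger singular value `λ₂(ξ)` of `ξ` (Mathlib lists singular values in decreasing
order, starting at index `0`). -/
noncomputable def sigmaMax (ξ : Mat2) : ℝ :=
  (Matrix.toLpLin 2 2 ξ).singularValues 0

/-- The smaller singular value `λ₁(ξ)` of `ξ`. -/
noncomputable def sigmaMin (ξ : Mat2) : ℝ :=
  (Matrix.toLpLin 2 2 ξ).singularValues 1

/-- `f : ℝ²ˣ² → ℝ ∪ {+∞}` is rank one convex: it is convex along every segment whose end points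
differ by a matrix of rank at most one. Here `ℝ ∪ {+∞}` is realised as the extended reals
without `⊥`, in which `0 * ⊤ = 0`. -/
def IsRankOneConvex (f : Mat2 → EReal) : Prop :=
  (∀ ξ, f ξ ≠ ⊥) ∧
    ∀ A B : Mat2, (A - B).rank ≤ 1 → ∀ t ∈ Icc (0 : ℝ) 1,
      f (t • A + (1 - t) • B) ≤ (t : EReal) * f A + ((1 - t : ℝ) : EReal) * f B

/-- The rank one convex hull of `E`: the set of points at which every rank one convex
`f : ℝ²ˣ² → ℝ ∪ {+∞}` that is nonpositive on `E` is nonpositive. -/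
def Rco (E : Set Mat2) : Set Mat2 :=
  {ξ | ∀ f : Mat2 → EReal, IsRankOneConvex f → (∀ ζ ∈ E, f ζ ≤ 0) → f ξ ≤ 0}

/-- The set `E` of matrices whose singular values `(λ₁(ξ), λ₂(ξ))` lie in `K`. -/
def isotropicSet (K : Set (ℝ × ℝ)) : Set Mat2 :=
  {ξ | (sigmaMin ξ, sigmaMax ξ) ∈ K}

/-- The set `E_δ`: the union over `(a, b) ∈ K` of the sets of matrices with singular values
`(a - δ, b - δ)`. -/
def shiftedSet (K : Set (ℝ × ℝ)) (δ : ℝ) : Set Mat2 :=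
  ⋃ p ∈ K, {ξ | (sigmaMin ξ, sigmaMax ξ) = (p.1 - δ, p.2 - δ)}

/-- The distance from a matrix to a set, for the Euclidean (Frobenius) norm on `ℝ²ˣ²`;
it is `∞` for the empty set. -/
noncomputable def frobeniusDist (η : Mat2) (E : Set Mat2) : ENNReal :=
  ⨅ ζ ∈ E, ENNReal.ofReal (√(∑ i, ∑ j, (η i j - ζ i j) ^ 2))

/-- The families `F δ` (for `E_δ`) and `KF δ` (for `K(E_δ)`), indexed by the positive numbers `δ`
in `D` (which contains all sufficiently small ones), satisfy the requirements of the approximation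
property for `E` and `KE`. -/
structure IsApproximatingFamily (D : Set ℝ) (E KE : Set Mat2) (F KF : ℝ → Set Mat2) : Prop where
  index_pos : ∀ δ ∈ D, 0 < δ
  index_mem : D ∈ 𝓝[>] (0 : ℝ)
  isClosed_left : ∀ δ ∈ D, IsClosed (F δ)
  isClosed_right : ∀ δ ∈ D, IsClosed (KF δ)
  subset_hull : ∀ δ ∈ D, F δ ⊆ KF δ
  subset_interior : ∀ δ ∈ D, KF δ ⊆ interior KE
  dist_le : ∀ ε > (0 : ℝ), ∃ δ₀ > (0 : ℝ), ∀ δ ∈ Icc 0 δ₀, ∀ η ∈ F δ,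
    frobeniusDist η E ≤ ENNReal.ofReal ε
  mem_of_interior : ∀ η ∈ interior KE, ∃ δ₀ > (0 : ℝ), ∀ δ ∈ Ioc 0 δ₀, η ∈ KF δ

/-- `E` and `KE` have the approximation property: `E ⊆ KE`, and there are approximating families
indexed by all `δ > 0`. -/
def HasApproximationProperty (E KE : Set Mat2) : Prop :=
  E ⊆ KE ∧ ∃ F KF : ℝ → Set Mat2, IsApproximatingFamily (Ioi 0) E KE F KF

/-!
The rank one convex hull is the lamination convex hull, and for the isotropic set `E` of a compact
set `K` of positive pairs it has an explicit description. Put `level θ (x, y) = x y + θ (y - x)`,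
let `maxLevel K θ` be its maximum over `K` and `height K` the largest singular value in `K`. Then
`Rco E` consists of the matrices whose singular values satisfy `level θ ≤ maxLevel K θ` for all
`θ ∈ [0, height K]` (`Rco_isotropicSet`).

Write a matrix as a conformal part `z` and an anticonformal part `w`, both complex numbers. Its
singular values are `|z| + |w|` and `||z| - |w||`, its determinant is `|z|² - |w|²`, and rank one
directions are those with `|z| = |w|`.

* The described set is lamination convex: since `level θ (x, y) = θ² + (y - θ) (x + θ)`, one has
  `maxLevel K θ ≥ θ²`, and under this bound `level θ ≤ maxLevel K θ` means that both
  `det + 2 θ |w|` and `- det + 2 θ |z|` are at most `maxLevel K θ` (`level_profile_le_iff`). These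
  functions are convex in rank one directions.
* Conversely, the segments `t ↦ (e (t - θ + i s), e' t)` have rank one directions and run in level
  sets of `level θ`. A matrix in the described set lies on such a segment between two matrices at
  which some `level θ` reaches its maximum over `K`, and these lie on such segments between matrices
  of `E`; the contact points of `K` on either side are limits of maximum points for nearby values
  of `θ` (`exists_contact_right`, `exists_contact_left`).

Closedness of the hull is then continuity of a maximum over a compact set of parameters. Replacing
`K` by its translate by `(-δ, -δ)` lowers each maximum strictly, so the hull of the shifted set
satisfies strict inequalities, and these cut out the interior
(`mem_interior_Rco_isotropicSet_iff`). As the maxima drop by at most `2 δ height K`, every interior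
point stays in the shifted hulls for small `δ`.
-/

/-! ### Conformal coordinates and singular values -/

/-- The conformal part of `ξ`, as a complex number: as a real linear map of `ℂ`, the matrix `ξ`
acts by `u ↦ conf ξ * u + anti ξ * conj u`. -/
noncomputable def conf (ξ : Mat2) : ℂ := ⟨(ξ 0 0 + ξ 1 1) / 2, (ξ 1 0 - ξ 0 1) / 2⟩

/-- The anticonformal part of `ξ`, as a complex number. -/
noncomputable def anti (ξ : Mat2) : ℂ := ⟨(ξ 0 0 - ξ 1 1) / 2, (ξ 1 0 + ξ 0 1) / 2⟩

/-- The matrix with conformal part `c.1` and anticonformal part `c.2`. -/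
def ofConf (c : ℂ × ℂ) : Mat2 :=
  !![c.1.re + c.2.re, c.2.im - c.1.im; c.1.im + c.2.im, c.1.re - c.2.re]

@[simp] lemma conf_ofConf (c : ℂ × ℂ) : conf (ofConf c) = c.1 := by
  apply Complex.ext
  · simp [conf, ofConf]
  · simp [conf, ofConf]
    ring

@[simp] lemma anti_ofConf (c : ℂ × ℂ) : anti (ofConf c) = c.2 := by
  apply Complex.ext
  · simp [anti, ofConf]
  · simp [anti, ofConf]
    ring

@[simp] lemma ofConf_conf_anti (ξ : Mat2) : ofConf (conf ξ, anti ξ) = ξ := by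
  ext i j
  fin_cases i <;> fin_cases j <;> simp [conf, anti, ofConf] <;> ring

lemma conf_sub (ξ η : Mat2) : conf (ξ - η) = conf ξ - conf η := by
  apply Complex.ext <;> simp [conf] <;> ring

lemma anti_sub (ξ η : Mat2) : anti (ξ - η) = anti ξ - anti η := by
  apply Complex.ext <;> simp [anti] <;> ring

lemma conf_comb (a b : ℝ) (ξ η : Mat2) :
    conf (a • ξ + b • η) = a • conf ξ + b • conf η := by
  apply Complex.ext <;> simp [conf] <;> ring

lemma anti_comb (a b : ℝ) (ξ η : Mat2) :
    anti (a • ξ + b • η) = a • anti ξ + b • anti η := by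
  apply Complex.ext <;> simp [anti] <;> ring

lemma ofConf_comb (a b : ℝ) (c d : ℂ × ℂ) :
    ofConf (a • c + b • d) = a • ofConf c + b • ofConf d := by
  ext i j
  fin_cases i <;> fin_cases j <;> simp [ofConf] <;> ring

lemma continuous_conf : Continuous conf := by
  have : conf = fun ξ : Mat2 => (((ξ 0 0 + ξ 1 1) / 2 : ℝ) : ℂ) +
      (((ξ 1 0 - ξ 0 1) / 2 : ℝ) : ℂ) * Complex.I := by
    funext ξ
    apply Complex.ext <;> simp [conf]
  rw [this]
  fun_prop

lemma continuous_anti : Continuous anti := by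
  have : anti = fun ξ : Mat2 => (((ξ 0 0 - ξ 1 1) / 2 : ℝ) : ℂ) +
      (((ξ 1 0 + ξ 0 1) / 2 : ℝ) : ℂ) * Complex.I := by
    funext ξ
    apply Complex.ext <;> simp [anti]
  rw [this]
  fun_prop

lemma det_eq_conf_anti (ξ : Mat2) : ξ.det = ‖conf ξ‖ ^ 2 - ‖anti ξ‖ ^ 2 := by
  rw [Complex.sq_norm, Complex.sq_norm, Complex.normSq_apply, Complex.normSq_apply,
    Matrix.det_fin_two]
  simp only [conf, anti]
  ring

lemma sum_sq_eq_conf_anti (ξ : Mat2) :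
    ∑ i, ∑ j, ξ i j ^ 2 = 2 * (‖conf ξ‖ ^ 2 + ‖anti ξ‖ ^ 2) := by
  rw [Complex.sq_norm, Complex.sq_norm, Complex.normSq_apply, Complex.normSq_apply]
  simp only [conf, anti, Fin.sum_univ_two]
  ring

lemma rank_le_one_iff_norm_conf_eq (ξ : Mat2) : ξ.rank ≤ 1 ↔ ‖conf ξ‖ = ‖anti ξ‖ := by
  have key : ξ.rank ≤ 1 ↔ ξ.det = 0 := by
    constructor
    · intro h
      by_contra hd
      have := Matrix.rank_of_det_ne_zero hd
      simp at this
      omega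
    · intro hd
      obtain ⟨v, hv, hv0⟩ := Matrix.exists_mulVec_eq_zero_iff.mpr hd
      have h1 := LinearMap.finrank_range_add_finrank_ker ξ.mulVecLin
      have h2 : 0 < Module.finrank ℝ (LinearMap.ker ξ.mulVecLin) := by
        rw [Module.finrank_pos_iff_exists_ne_zero]
        exact ⟨⟨v, by simpa using hv0⟩, by simpa [Subtype.ext_iff] using hv⟩
      simp only [Module.finrank_fintype_fun_eq_card, Fintype.card_fin] at h1
      rw [Matrix.rank]
      omega
  rw [key, det_eq_conf_anti, sub_eq_zero]
  exact sq_eq_sq₀ (norm_nonneg _) (norm_nonneg _)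

lemma sigmaMin_nonneg (ξ : Mat2) : 0 ≤ sigmaMin ξ := LinearMap.singularValues_nonneg _ _

lemma sigmaMin_le_sigmaMax (ξ : Mat2) : sigmaMin ξ ≤ sigmaMax ξ :=
  LinearMap.singularValues_antitone _ zero_le_one

lemma sigma_sq_add_and_mul (ξ : Mat2) :
    sigmaMax ξ ^ 2 + sigmaMin ξ ^ 2 = ∑ i, ∑ j, ξ i j ^ 2 ∧
      sigmaMax ξ ^ 2 * sigmaMin ξ ^ 2 = ξ.det ^ 2 := by
  set T := Matrix.toLpLin 2 2 ξ with hT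
  have hn : Module.finrank ℝ (WithLp 2 (Fin 2 → ℝ)) = 2 := by simp
  have hs := T.isSymmetric_adjoint_comp_self
  have h0 := T.sq_singularValues_fin hn 0
  have h1 := T.sq_singularValues_fin hn 1
  have hadj : LinearMap.adjoint T ∘ₗ T = Matrix.toLpLin 2 2 (ξ.transpose * ξ) := by
    have := Matrix.toEuclideanLin_conjTranspose_eq_adjoint ξ
    rw [Matrix.conjTranspose_eq_transpose_of_trivial] at this
    rw [hT, Matrix.toLpLin_mul_same]
    exact congrArg (· ∘ₗ Matrix.toLpLin 2 2 ξ) this.symm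
  have htr := hs.trace_eq_sum_eigenvalues hn
  have hdet := hs.det_eq_prod_eigenvalues hn
  simp only [Fin.sum_univ_two, Fin.prod_univ_two, RCLike.ofReal_real_eq_id, id] at htr hdet
  rw [← h0, ← h1] at htr hdet
  rw [hadj, Matrix.toLpLin_eq_toLin, Matrix.trace_toLin_eq] at htr
  rw [hadj, LinearMap.det_toLpLin, Matrix.det_mul, Matrix.det_transpose] at hdet
  change _ = sigmaMax ξ ^ 2 + sigmaMin ξ ^ 2 at htr
  change _ = sigmaMax ξ ^ 2 * sigmaMin ξ ^ 2 at hdet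
  refine ⟨?_, by rw [← hdet]; ring⟩
  rw [← htr]
  simp [Matrix.trace, Matrix.mul_apply, Fin.sum_univ_two]
  ring

/-- The singular values are the sum and the distance of the moduli of the two parts. -/
lemma sigma_eq (ξ : Mat2) :
    sigmaMin ξ = |‖conf ξ‖ - ‖anti ξ‖| ∧ sigmaMax ξ = ‖conf ξ‖ + ‖anti ξ‖ := by
  obtain ⟨h1, h2⟩ := sigma_sq_add_and_mul ξ
  rw [sum_sq_eq_conf_anti] at h1
  rw [det_eq_conf_anti] at h2
  have hm := sigmaMin_nonneg ξ
  have hle := sigmaMin_le_sigmaMax ξ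
  set p := ‖conf ξ‖
  set q := ‖anti ξ‖
  have hp : 0 ≤ p := norm_nonneg _
  have hq : 0 ≤ q := norm_nonneg _
  have hmul : sigmaMax ξ * sigmaMin ξ = |p ^ 2 - q ^ 2| := by
    rw [← abs_of_nonneg (mul_nonneg (hm.trans hle) hm)]
    apply (sq_eq_sq_iff_abs_eq_abs _ _).1
    rw [mul_pow, h2]
  rcases le_total q p with h | h
  · rw [abs_of_nonneg (by nlinarith)] at hmul
    rw [abs_of_nonneg (by linarith)]
    have ha : sigmaMax ξ + sigmaMin ξ = 2 * p :=
      (sq_eq_sq₀ (by linarith) (by linarith)).1 (by nlinarith)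
    have hb : sigmaMax ξ - sigmaMin ξ = 2 * q :=
      (sq_eq_sq₀ (by linarith) (by linarith)).1 (by nlinarith)
    constructor <;> linarith
  · rw [abs_of_nonpos (by nlinarith)] at hmul
    rw [abs_of_nonpos (by linarith)]
    have ha : sigmaMax ξ + sigmaMin ξ = 2 * q :=
      (sq_eq_sq₀ (by linarith) (by linarith)).1 (by nlinarith)
    have hb : sigmaMax ξ - sigmaMin ξ = 2 * p :=
      (sq_eq_sq₀ (by linarith) (by linarith)).1 (by nlinarith)
    constructor <;> linarith

/-- The pair of singular values in terms of the moduli of the two parts. -/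
noncomputable def profile (c : ℂ × ℂ) : ℝ × ℝ := (|‖c.1‖ - ‖c.2‖|, ‖c.1‖ + ‖c.2‖)

lemma profile_swap (c : ℂ × ℂ) : profile c.swap = profile c := by
  simp [profile, abs_sub_comm, add_comm]

lemma continuous_profile : Continuous profile := by
  unfold profile
  fun_prop

lemma sigma_pair_eq (ξ : Mat2) : (sigmaMin ξ, sigmaMax ξ) = profile (conf ξ, anti ξ) :=
  Prod.ext (sigma_eq ξ).1 (sigma_eq ξ).2

lemma sigma_pair_ofConf (c : ℂ × ℂ) :
    (sigmaMin (ofConf c), sigmaMax (ofConf c)) = profile c := by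
  simp [sigma_pair_eq]

lemma continuous_sigma_pair : Continuous fun ξ : Mat2 => (sigmaMin ξ, sigmaMax ξ) := by
  simp_rw [sigma_pair_eq]
  exact continuous_profile.comp (continuous_conf.prodMk continuous_anti)

/-! ### Rank one convex hulls as lamination convex hulls -/

/-- A set of matrices is lamination convex if it contains every segment whose end points lie
in it and differ by a matrix of rank at most one. -/
def IsLaminationConvex (L : Set Mat2) : Prop :=
  ∀ A ∈ L, ∀ B ∈ L, (A - B).rank ≤ 1 → ∀ t ∈ Icc (0 : ℝ) 1, t • A + (1 - t) • B ∈ L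

/-- The indicator function of a lamination convex set, `0` on the set and `⊤` off it, is rank one
convex; so the hull lies in the set. -/
lemma Rco_subset {E L : Set Mat2} (hL : IsLaminationConvex L) (hEL : E ⊆ L) : Rco E ⊆ L := by
  classical
  intro ξ hξ
  have h := hξ (fun ζ => if ζ ∈ L then 0 else ⊤) ⟨fun ζ => by dsimp only; split_ifs <;> simp, ?_⟩
    fun ζ hζ => by simp [hEL hζ]
  · by_contra hn
    simp [hn] at h
  · intro A B hr t ht
    rcases ht.1.eq_or_lt with rfl | h0
    · simp
    rcases ht.2.eq_or_lt with rfl | h1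
    · simp
    by_cases hA : A ∈ L <;> by_cases hB : B ∈ L
    · simp [hA, hB, hL A hA B hB hr t ht]
    · simp only [hA, hB, if_true, if_false, mul_zero, zero_add]
      rw [EReal.coe_mul_top_of_pos (by linarith)]
      exact le_top
    · simp only [hA, hB, if_true, if_false, mul_zero, add_zero]
      rw [EReal.coe_mul_top_of_pos h0]
      exact le_top
    · simp only [hA, hB, if_false]
      rw [EReal.coe_mul_top_of_pos h0, EReal.coe_mul_top_of_pos (by linarith)]
      simp

lemma subset_Rco (E : Set Mat2) : E ⊆ Rco E := fun _ hξ _ _ hf => hf _ hξ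

lemma isLaminationConvex_Rco (E : Set Mat2) : IsLaminationConvex (Rco E) := by
  intro A hA B hB hr t ht f hf hfE
  refine (hf.2 A B hr t ht).trans ?_
  refine add_nonpos ?_ ?_
  · exact mul_nonpos_of_nonneg_of_nonpos (EReal.coe_nonneg.2 ht.1) (hA f hf hfE)
  · exact mul_nonpos_of_nonneg_of_nonpos (EReal.coe_nonneg.2 (by linarith [ht.2])) (hB f hf hfE)

/-! ### The level functions and the candidate for the hull -/

/-- The function `x y + θ (y - x)` of the pair `(x, y)` of singular values. -/
def level (θ : ℝ) (p : ℝ × ℝ) : ℝ := p.1 * p.2 + θ * (p.2 - p.1)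

/-- The maximum of `level θ` on `K`. -/
noncomputable def maxLevel (K : Set (ℝ × ℝ)) (θ : ℝ) : ℝ := sSup (level θ '' K)

/-- The largest second coordinate of a point of `K`. -/
noncomputable def height (K : Set (ℝ × ℝ)) : ℝ := sSup (Prod.snd '' K)

/-- The pairs of singular values whose `level θ` does not exceed its maximum on `K`, for every
`θ` between `0` and the height of `K`. These turn out to be the pairs that belong to matrices in
the rank one convex hull. -/
def levelHull (K : Set (ℝ × ℝ)) : Set (ℝ × ℝ) :=
  {p | ∀ θ ∈ Icc 0 (height K), level θ p ≤ maxLevel K θ}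

/-- The largest excess of `level θ p` over the maximum on `K`, for `θ` between `0` and the height
of `K`; it is nonpositive exactly on `levelHull K`. -/
noncomputable def excess (K : Set (ℝ × ℝ)) (p : ℝ × ℝ) : ℝ :=
  sSup ((fun θ => level θ p - maxLevel K θ) '' Icc 0 (height K))

lemma level_eq_sq_add (θ : ℝ) (p : ℝ × ℝ) :
    level θ p = θ ^ 2 + (p.2 - θ) * (p.1 + θ) := by
  unfold level
  ring

lemma continuous_level : Continuous fun x : ℝ × (ℝ × ℝ) => level x.1 x.2 := by
  unfold level
  fun_prop

lemma level_profile {c : ℂ × ℂ} (h : ‖c.2‖ ≤ ‖c.1‖) (θ : ℝ) :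
    level θ (profile c) = ‖c.1‖ ^ 2 - ‖c.2‖ ^ 2 + 2 * θ * ‖c.2‖ := by
  simp only [level, profile]
  rw [abs_of_nonneg (by linarith)]
  ring

section

variable {K : Set (ℝ × ℝ)}

lemma continuous_maxLevel (hK : IsCompact K) : Continuous (maxLevel K) :=
  hK.continuous_sSup (f := level) continuous_level

lemma level_le_maxLevel (hK : IsCompact K) {k : ℝ × ℝ} (hk : k ∈ K) (θ : ℝ) :
    level θ k ≤ maxLevel K θ :=
  le_csSup (hK.image (by unfold level; fun_prop)).bddAbove (mem_image_of_mem _ hk)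

lemma exists_maxLevel_eq (hK : IsCompact K) (hne : K.Nonempty) (θ : ℝ) :
    ∃ k ∈ K, maxLevel K θ = level θ k :=
  hK.exists_sSup_image_eq hne (by unfold level; fun_prop)

lemma le_height (hK : IsCompact K) {k : ℝ × ℝ} (hk : k ∈ K) : k.2 ≤ height K :=
  le_csSup (hK.image continuous_snd).bddAbove (mem_image_of_mem _ hk)

lemma exists_height_eq (hK : IsCompact K) (hne : K.Nonempty) : ∃ k ∈ K, height K = k.2 :=
  hK.exists_sSup_image_eq hne continuous_snd.continuousOn

lemma height_pos (hK : IsCompact K) (hne : K.Nonempty) (hT : ∀ p ∈ K, 0 < p.1 ∧ p.1 ≤ p.2) :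
    0 < height K := by
  obtain ⟨k, hk⟩ := hne
  linarith [hT k hk, le_height hK hk]

lemma sq_le_maxLevel (hK : IsCompact K) (hne : K.Nonempty)
    (hT : ∀ p ∈ K, 0 < p.1 ∧ p.1 ≤ p.2) {θ : ℝ} (hθ : θ ∈ Icc 0 (height K)) :
    θ ^ 2 ≤ maxLevel K θ := by
  obtain ⟨k, hk, hkB⟩ := exists_height_eq hK hne
  refine le_trans ?_ (level_le_maxLevel hK hk θ)
  rw [level_eq_sq_add]
  have := mul_nonneg (sub_nonneg.2 (hkB ▸ hθ.2)) (add_nonneg (hT k hk).1.le hθ.1)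
  linarith

lemma maxLevel_height (hK : IsCompact K) (hne : K.Nonempty)
    (hT : ∀ p ∈ K, 0 < p.1 ∧ p.1 ≤ p.2) : maxLevel K (height K) = height K ^ 2 := by
  have hB := height_pos hK hne hT
  refine le_antisymm ?_ (sq_le_maxLevel hK hne hT ⟨hB.le, le_rfl⟩)
  obtain ⟨k, hk, h⟩ := exists_maxLevel_eq hK hne (height K)
  rw [h, level_eq_sq_add]
  nlinarith [le_height hK hk, hT k hk]

lemma snd_le_height_of_mem_levelHull (hK : IsCompact K) (hne : K.Nonempty)
    (hT : ∀ p ∈ K, 0 < p.1 ∧ p.1 ≤ p.2) {p : ℝ × ℝ} (hp0 : 0 ≤ p.1) (hp : p ∈ levelHull K) :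
    p.2 ≤ height K := by
  have hB := height_pos hK hne hT
  have h := hp (height K) ⟨hB.le, le_rfl⟩
  rw [maxLevel_height hK hne hT, level_eq_sq_add] at h
  by_contra! hlt
  nlinarith

lemma continuous_excess (hK : IsCompact K) : Continuous (excess K) := by
  refine isCompact_Icc.continuous_sSup (f := fun p θ => level θ p - maxLevel K θ) ?_
  exact (continuous_level.comp continuous_swap).sub ((continuous_maxLevel hK).comp continuous_snd)

lemma continuous_level_sub_maxLevel (hK : IsCompact K) (p : ℝ × ℝ) :
    Continuous fun θ => level θ p - maxLevel K θ :=
  (continuous_level.comp (by fun_prop : Continuous fun θ : ℝ => (θ, p))).sub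
    (continuous_maxLevel hK)

lemma level_sub_maxLevel_le_excess (hK : IsCompact K) (p : ℝ × ℝ) {θ : ℝ}
    (hθ : θ ∈ Icc 0 (height K)) : level θ p - maxLevel K θ ≤ excess K p :=
  le_csSup (isCompact_Icc.image (continuous_level_sub_maxLevel hK p)).bddAbove
    (mem_image_of_mem _ hθ)

lemma exists_excess_eq (hK : IsCompact K) (hne : K.Nonempty)
    (hT : ∀ p ∈ K, 0 < p.1 ∧ p.1 ≤ p.2) (p : ℝ × ℝ) :
    ∃ θ ∈ Icc 0 (height K), excess K p = level θ p - maxLevel K θ :=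
  isCompact_Icc.exists_sSup_image_eq (nonempty_Icc.2 (height_pos hK hne hT).le)
    (continuous_level_sub_maxLevel hK p).continuousOn

lemma mem_levelHull_iff (hK : IsCompact K) (hne : K.Nonempty)
    (hT : ∀ p ∈ K, 0 < p.1 ∧ p.1 ≤ p.2) {p : ℝ × ℝ} : p ∈ levelHull K ↔ excess K p ≤ 0 := by
  constructor
  · intro h
    obtain ⟨θ, hθ, he⟩ := exists_excess_eq hK hne hT p
    linarith [h θ hθ]
  · intro h θ hθ
    linarith [level_sub_maxLevel_le_excess hK p hθ]

lemma excess_neg_of_forall_lt (hK : IsCompact K) (hne : K.Nonempty)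
    (hT : ∀ p ∈ K, 0 < p.1 ∧ p.1 ≤ p.2) {p : ℝ × ℝ}
    (h : ∀ θ ∈ Icc 0 (height K), level θ p < maxLevel K θ) : excess K p < 0 := by
  obtain ⟨θ, hθ, he⟩ := exists_excess_eq hK hne hT p
  linarith [h θ hθ]

lemma subset_levelHull (hK : IsCompact K) : K ⊆ levelHull K :=
  fun _ hk θ _ => level_le_maxLevel hK hk θ

/-- On the boundary of `levelHull K`, where `level θ` attains its maximum over `K`, the set `K` has
a point on the same level line with at least the same difference of coordinates: it is a limit of
maximum points on `K` of `level θ'` as `θ'` decreases to `θ`. -/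
lemma exists_contact_right (hK : IsCompact K) (hne : K.Nonempty) {p : ℝ × ℝ}
    (hp : p ∈ levelHull K) {θ : ℝ} (h0 : 0 ≤ θ) (h1 : θ < height K)
    (hθ : level θ p = maxLevel K θ) :
    ∃ k ∈ K, level θ k = maxLevel K θ ∧ p.2 - p.1 ≤ k.2 - k.1 := by
  set K' := K ∩ {k | p.2 - p.1 ≤ k.2 - k.1}
  have hcK' : IsCompact K' := hK.inter_right (isClosed_le (by fun_prop) (by fun_prop))
  have key : ∀ θ' ∈ Ioc θ (height K), ∃ k ∈ K', level θ' p ≤ level θ' k := by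
    intro θ' hθ'
    obtain ⟨k, hk, hmax⟩ := exists_maxLevel_eq hK hne θ'
    have hge := hp θ' ⟨h0.trans hθ'.1.le, hθ'.2⟩
    have hle := level_le_maxLevel hK hk θ
    refine ⟨k, ⟨hk, ?_⟩, hmax ▸ hge⟩
    rw [hmax] at hge
    rw [← hθ] at hle
    simp only [level, mem_ofPred_eq] at hge hle ⊢
    by_contra! hlt
    nlinarith [hθ'.1]
  have hneK' : K'.Nonempty := by
    obtain ⟨k, hk, -⟩ := key (height K) ⟨h1, le_rfl⟩
    exact ⟨k, hk⟩
  have hlim : level θ p ≤ maxLevel K' θ := by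
    have hc1 : Tendsto (fun θ' => level θ' p) (𝓝[>] θ) (𝓝 (level θ p)) :=
      (Continuous.tendsto (by unfold level; fun_prop) θ).mono_left nhdsWithin_le_nhds
    have hc2 : Tendsto (maxLevel K') (𝓝[>] θ) (𝓝 (maxLevel K' θ)) :=
      ((continuous_maxLevel hcK').tendsto θ).mono_left nhdsWithin_le_nhds
    refine le_of_tendsto_of_tendsto hc1 hc2 ?_
    filter_upwards [Ioc_mem_nhdsGT h1] with θ' hθ'
    obtain ⟨k, hk, hle⟩ := key θ' hθ'
    exact hle.trans (level_le_maxLevel hcK' hk θ')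
  obtain ⟨k, hk, hmax⟩ := exists_maxLevel_eq hcK' hneK' θ
  exact ⟨k, hk.1, le_antisymm (level_le_maxLevel hK hk.1 θ) (by rw [← hθ, ← hmax]; exact hlim),
    hk.2⟩

lemma exists_contact_left (hK : IsCompact K) (hne : K.Nonempty) {p : ℝ × ℝ}
    (hp : p ∈ levelHull K) {θ : ℝ} (h0 : 0 < θ) (h1 : θ ≤ height K)
    (hθ : level θ p = maxLevel K θ) :
    ∃ k ∈ K, level θ k = maxLevel K θ ∧ k.2 - k.1 ≤ p.2 - p.1 := by
  set K' := K ∩ {k | k.2 - k.1 ≤ p.2 - p.1}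
  have hcK' : IsCompact K' := hK.inter_right (isClosed_le (by fun_prop) (by fun_prop))
  have key : ∀ θ' ∈ Ico 0 θ, ∃ k ∈ K', level θ' p ≤ level θ' k := by
    intro θ' hθ'
    obtain ⟨k, hk, hmax⟩ := exists_maxLevel_eq hK hne θ'
    have hge := hp θ' ⟨hθ'.1, hθ'.2.le.trans h1⟩
    have hle := level_le_maxLevel hK hk θ
    refine ⟨k, ⟨hk, ?_⟩, hmax ▸ hge⟩
    rw [hmax] at hge
    rw [← hθ] at hle
    simp only [level, mem_ofPred_eq] at hge hle ⊢
    by_contra! hlt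
    nlinarith [hθ'.2]
  have hneK' : K'.Nonempty := by
    obtain ⟨k, hk, -⟩ := key 0 ⟨le_rfl, h0⟩
    exact ⟨k, hk⟩
  have hlim : level θ p ≤ maxLevel K' θ := by
    have hc1 : Tendsto (fun θ' => level θ' p) (𝓝[<] θ) (𝓝 (level θ p)) :=
      (Continuous.tendsto (by unfold level; fun_prop) θ).mono_left nhdsWithin_le_nhds
    have hc2 : Tendsto (maxLevel K') (𝓝[<] θ) (𝓝 (maxLevel K' θ)) :=
      ((continuous_maxLevel hcK').tendsto θ).mono_left nhdsWithin_le_nhds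
    refine le_of_tendsto_of_tendsto hc1 hc2 ?_
    filter_upwards [Ico_mem_nhdsLT h0] with θ' hθ'
    obtain ⟨k, hk, hle⟩ := key θ' hθ'
    exact hle.trans (level_le_maxLevel hcK' hk θ')
  obtain ⟨k, hk, hmax⟩ := exists_maxLevel_eq hcK' hneK' θ
  exact ⟨k, hk.1, le_antisymm (level_le_maxLevel hK hk.1 θ) (by rw [← hθ, ← hmax]; exact hlim),
    hk.2⟩

/-! ### The candidate is lamination convex -/

/-- For `θ² ≤ M` the condition `level θ ≤ M` splits into two conditions without distinction of
cases, each of which is polyconvex: the first summands are plus and minus the determinant. -/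
lemma level_profile_le_iff {θ M : ℝ} (hM : θ ^ 2 ≤ M) (c : ℂ × ℂ) :
    level θ (profile c) ≤ M ↔ ‖c.1‖ ^ 2 - ‖c.2‖ ^ 2 + 2 * θ * ‖c.2‖ ≤ M ∧
      ‖c.2‖ ^ 2 - ‖c.1‖ ^ 2 + 2 * θ * ‖c.1‖ ≤ M := by
  wlog h : ‖c.2‖ ≤ ‖c.1‖ generalizing c
  · have := this c.swap (le_of_not_ge h)
    rw [profile_swap] at this
    rw [this, and_comm]
    rfl
  rw [level_profile h]
  refine ⟨fun h1 => ⟨h1, ?_⟩, fun h1 => h1.1⟩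
  have hq := norm_nonneg c.2
  rcases le_total θ (‖c.1‖ + ‖c.2‖) with h2 | h2
  · nlinarith
  · nlinarith

lemma norm_sq_comb (t : ℝ) (z w : ℂ) :
    ‖t • z + (1 - t) • w‖ ^ 2 =
      t * ‖z‖ ^ 2 + (1 - t) * ‖w‖ ^ 2 - t * (1 - t) * ‖z - w‖ ^ 2 := by
  simp only [Complex.sq_norm, Complex.normSq_apply]
  simp
  ring

lemma norm_comb_le {t : ℝ} (ht : t ∈ Icc (0 : ℝ) 1) (z w : ℂ) :
    ‖t • z + (1 - t) • w‖ ≤ t * ‖z‖ + (1 - t) * ‖w‖ := by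
  refine (norm_add_le _ _).trans ?_
  rw [norm_smul, norm_smul, Real.norm_of_nonneg ht.1, Real.norm_of_nonneg (by linarith [ht.2])]

/-- The difference of squared moduli is affine along segments with `‖z - z'‖ = ‖w - w'‖`, and
moduli are convex. -/
lemma norm_sq_sub_add_comb_le {t θ M : ℝ} (ht : t ∈ Icc (0 : ℝ) 1) (hθ : 0 ≤ θ) {z z' w w' : ℂ}
    (hd : ‖z - z'‖ = ‖w - w'‖) (h : ‖z‖ ^ 2 - ‖w‖ ^ 2 + 2 * θ * ‖w‖ ≤ M)
    (h' : ‖z'‖ ^ 2 - ‖w'‖ ^ 2 + 2 * θ * ‖w'‖ ≤ M) :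
    ‖t • z + (1 - t) • z'‖ ^ 2 - ‖t • w + (1 - t) • w'‖ ^ 2 + 2 * θ * ‖t • w + (1 - t) • w'‖
      ≤ M := by
  rw [norm_sq_comb, norm_sq_comb, hd]
  have h1 := mul_le_mul_of_nonneg_left (norm_comb_le ht w w') hθ
  have h2 := mul_le_mul_of_nonneg_left h ht.1
  have h3 := mul_le_mul_of_nonneg_left h' (sub_nonneg.2 ht.2)
  linarith

lemma isLaminationConvex_levelHull (hK : IsCompact K) (hne : K.Nonempty)
    (hT : ∀ p ∈ K, 0 < p.1 ∧ p.1 ≤ p.2) :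
    IsLaminationConvex {ξ | (sigmaMin ξ, sigmaMax ξ) ∈ levelHull K} := by
  intro A hA B hB hr t ht θ hθ
  have hM := sq_le_maxLevel hK hne hT hθ
  have hA' := hA θ hθ
  have hB' := hB θ hθ
  rw [rank_le_one_iff_norm_conf_eq, conf_sub, anti_sub] at hr
  rw [sigma_pair_eq, level_profile_le_iff hM] at hA' hB' ⊢
  rw [conf_comb, anti_comb]
  exact ⟨norm_sq_sub_add_comb_le ht hθ.1 hr hA'.1 hB'.1,
    norm_sq_sub_add_comb_le ht hθ.1 hr.symm hA'.2 hB'.2⟩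

end

/-! ### The candidate lies in the hull -/

/-- In conformal coordinates, lamination convexity is closedness under segments whose two
components have equal length. Unlike for matrices, the symmetry under swapping the components is
visible here. -/
def IsIsometricallyConvex (C : Set (ℂ × ℂ)) : Prop :=
  ∀ c ∈ C, ∀ d ∈ C, ‖c.1 - d.1‖ = ‖c.2 - d.2‖ → ∀ t ∈ Icc (0 : ℝ) 1, t • c + (1 - t) • d ∈ C

lemma IsLaminationConvex.preimage_ofConf {L : Set Mat2} (hL : IsLaminationConvex L) :
    IsIsometricallyConvex (ofConf ⁻¹' L) := by
  intro c hc d hd hcd t ht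
  rw [mem_preimage, ofConf_comb]
  refine hL _ hc _ hd ?_ t ht
  rw [rank_le_one_iff_norm_conf_eq, conf_sub, anti_sub]
  simpa using hcd

lemma IsIsometricallyConvex.preimage_swap {C : Set (ℂ × ℂ)} (hC : IsIsometricallyConvex C) :
    IsIsometricallyConvex (Prod.swap ⁻¹' C) :=
  fun c hc d hd hcd t ht => hC c.swap hc d.swap hd hcd.symm t ht

lemma exists_unit_mul_eq {z c : ℂ} (h : ‖z‖ = ‖c‖) : ∃ e : ℂ, ‖e‖ = 1 ∧ z = e * c := by
  by_cases hc : c = 0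
  · refine ⟨1, by simp, ?_⟩
    rw [hc, norm_zero, norm_eq_zero] at h
    simp [h, hc]
  · refine ⟨z / c, ?_, (div_mul_cancel₀ z hc).symm⟩
    rw [norm_div, h, div_self (norm_ne_zero_iff.2 hc)]

/-- Through every point there are segments `t ↦ (e (t - θ + i s), e' t)` with unit `e`, `e'`, along
which `|z|² - (|w| - θ)²` is the constant `s²` as long as `t ≥ 0`; this makes `level θ` constant
where also `|w| ≤ |z|`. -/
lemma IsIsometricallyConvex.mem_of_arc {C : Set (ℂ × ℂ)} (hC : IsIsometricallyConvex C)
    {θ s t₁ t₂ t : ℝ} (h₁ : t₁ ≤ t) (h₂ : t ≤ t₂)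
    (H₁ : ∀ c : ℂ × ℂ, ‖c.1‖ ^ 2 = (t₁ - θ) ^ 2 + s ^ 2 → ‖c.2‖ = |t₁| → c ∈ C)
    (H₂ : ∀ c : ℂ × ℂ, ‖c.1‖ ^ 2 = (t₂ - θ) ^ 2 + s ^ 2 → ‖c.2‖ = |t₂| → c ∈ C)
    {c : ℂ × ℂ} (hc₁ : ‖c.1‖ ^ 2 = (t - θ) ^ 2 + s ^ 2) (hc₂ : ‖c.2‖ = |t|) : c ∈ C := by
  rcases h₁.eq_or_lt with rfl | h₁'
  · exact H₁ c hc₁ hc₂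
  have hnorm : ∀ a : ℝ, ‖(⟨a - θ, s⟩ : ℂ)‖ ^ 2 = (a - θ) ^ 2 + s ^ 2 := by
    intro a
    rw [Complex.sq_norm, Complex.normSq_apply]
    ring
  obtain ⟨e, he, hce⟩ := exists_unit_mul_eq (z := c.1) (c := ⟨t - θ, s⟩)
    ((sq_eq_sq₀ (norm_nonneg _) (norm_nonneg _)).1 (by rw [hc₁, hnorm]))
  obtain ⟨e', he', hce'⟩ := exists_unit_mul_eq (z := c.2) (c := (t : ℂ)) (by simpa using hc₂)
  have hd : t₂ - t₁ ≠ 0 := by linarith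
  set τ := (t₂ - t) / (t₂ - t₁) with hτ
  have hτI : τ ∈ Icc (0 : ℝ) 1 :=
    ⟨div_nonneg (by linarith) (by linarith), (div_le_one (by linarith)).2 (by linarith)⟩
  have hcomb : τ * t₁ + (1 - τ) * t₂ = t := by
    rw [hτ]
    field_simp
    ring
  have key := hC (e * ⟨t₁ - θ, s⟩, e' * (t₁ : ℂ))
    (H₁ _ (by rw [norm_mul, he, one_mul, hnorm]) (by simp [he']))
    (e * ⟨t₂ - θ, s⟩, e' * (t₂ : ℂ))
    (H₂ _ (by rw [norm_mul, he, one_mul, hnorm]) (by simp [he'])) ?_ τ hτI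
  · convert key using 1
    have hz : (⟨t - θ, s⟩ : ℂ) = (τ : ℂ) * ⟨t₁ - θ, s⟩ + ((1 - τ : ℝ) : ℂ) * ⟨t₂ - θ, s⟩ := by
      apply Complex.ext <;> simp [← hcomb] <;> ring
    have hw : (t : ℂ) = (τ : ℂ) * t₁ + ((1 - τ : ℝ) : ℂ) * t₂ := by
      rw [← hcomb]
      push_cast
      ring
    apply Prod.ext
    · rw [hce, hz]
      simp only [Prod.fst_add, Prod.smul_fst, Complex.real_smul]
      ring
    · rw [hce', hw]
      simp only [Prod.snd_add, Prod.smul_snd, Complex.real_smul]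
      ring
  · have hz : (⟨t₁ - θ, s⟩ : ℂ) - ⟨t₂ - θ, s⟩ = ((t₁ - t₂ : ℝ) : ℂ) := by
      apply Complex.ext <;> simp
    rw [← mul_sub, ← mul_sub, norm_mul, norm_mul, he, he', hz, ← Complex.ofReal_sub]

section

variable {K : Set (ℝ × ℝ)} {C : Set (ℂ × ℂ)}

/-- Points at which some `level θ` attains its maximum over `K` lie on an arc between two points
that have their pair of singular values in `K`. For `θ = 0` and for `θ = height K` there is a
contact point of `K` on one side only; the second end point then comes from the symmetries
`w ↦ -w` and `(z, w) ↦ (w, z)`. -/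
lemma IsIsometricallyConvex.mem_of_level_eq (hC : IsIsometricallyConvex C) (hK : IsCompact K)
    (hne : K.Nonempty) (hT : ∀ p ∈ K, 0 < p.1 ∧ p.1 ≤ p.2) (hKC : ∀ c, profile c ∈ K → c ∈ C)
    {c : ℂ × ℂ} (hc : profile c ∈ levelHull K) {θ : ℝ} (hθ : θ ∈ Icc 0 (height K))
    (hlev : level θ (profile c) = maxLevel K θ) : c ∈ C := by
  wlog h : ‖c.2‖ ≤ ‖c.1‖ generalizing c C
  · exact this (C := Prod.swap ⁻¹' C) (c := c.swap) hC.preimage_swap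
      (fun d hd => hKC _ (by rwa [profile_swap])) (by rwa [profile_swap])
      (by rwa [profile_swap]) (le_of_not_ge h)
  have hB := height_pos hK hne hT
  have hv : (profile c).2 - (profile c).1 = 2 * ‖c.2‖ := by
    simp only [profile]
    rw [abs_of_nonneg (by linarith)]
    ring
  have hq := norm_nonneg c.2
  have hsq := sq_le_maxLevel hK hne hT hθ
  set s := √(maxLevel K θ - θ ^ 2) with hs
  have hs2 : s ^ 2 = maxLevel K θ - θ ^ 2 := Real.sq_sqrt (by linarith)
  have hcs : ‖c.1‖ ^ 2 = (‖c.2‖ - θ) ^ 2 + s ^ 2 := by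
    rw [level_profile h] at hlev
    rw [hs2, ← hlev]
    ring
  have hcq : ‖c.2‖ = |‖c.2‖| := (abs_of_nonneg hq).symm
  -- the arc reaches the pair `k` at the parameters `± (k.2 - k.1) / 2`
  have hend : ∀ k ∈ K, level θ k = maxLevel K θ → ∀ d : ℂ × ℂ,
      ‖d.1‖ ^ 2 = ((k.2 - k.1) / 2 - θ) ^ 2 + s ^ 2 → ‖d.2‖ = (k.2 - k.1) / 2 → d ∈ C := by
    intro k hk hkM d hd1 hd2
    have hk0 := hT k hk
    have hd1' : ‖d.1‖ = (k.1 + k.2) / 2 := by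
      refine (sq_eq_sq₀ (norm_nonneg _) (by linarith)).1 ?_
      rw [hd1, hs2, ← hkM]
      unfold level
      ring
    refine hKC d ?_
    have : profile d = k := by
      simp only [profile]
      rw [hd1', hd2]
      ext
      · rw [abs_of_nonneg (by linarith)]
        ring
      · simp only
        ring
    rwa [this]
  rcases hθ.2.eq_or_lt with htop | htop
  · obtain ⟨k, hk, hkM, hkv⟩ := exists_contact_left hK hne hc (htop ▸ hB) hθ.2 hlev
    have hk0 := hT k hk
    rw [hv] at hkv
    have hM : maxLevel K θ = θ ^ 2 := by rw [htop, maxLevel_height hK hne hT]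
    have hs0 : s = 0 := by simp [hs, hM]
    have hθ0 : 0 < θ := htop ▸ hB
    have hk2 : k.2 = θ := by
      rw [hM, level_eq_sq_add] at hkM
      have : (k.2 - θ) * (k.1 + θ) = 0 := by linarith
      rcases mul_eq_zero.1 this with h' | h' <;> linarith
    have hc2 : ‖c.1‖ + ‖c.2‖ = θ := by
      rw [hM, level_eq_sq_add] at hlev
      have : ((profile c).2 - θ) * ((profile c).1 + θ) = 0 := by linarith
      have h1 : 0 ≤ (profile c).1 := abs_nonneg _
      have h2 : (profile c).2 = ‖c.1‖ + ‖c.2‖ := rfl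
      rcases mul_eq_zero.1 this with h' | h' <;> linarith
    refine hC.mem_of_arc (t₁ := (k.2 - k.1) / 2) (t₂ := θ - (k.2 - k.1) / 2)
      (by linarith) (by linarith) ?_ ?_ hcs hcq
    · intro d hd1 hd2
      rw [abs_of_nonneg (by linarith)] at hd2
      exact hend k hk hkM d hd1 hd2
    · intro d hd1 hd2
      rw [abs_of_nonneg (by linarith)] at hd2
      have hd1' : ‖d.1‖ = (k.2 - k.1) / 2 := by
        refine (sq_eq_sq₀ (norm_nonneg _) (by linarith)).1 ?_
        rw [hd1, hs0]
        ring
      refine hKC d ?_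
      have : profile d = k := by
        simp only [profile]
        rw [hd1', hd2]
        ext
        · rw [abs_of_nonpos (by linarith), hk2]
          ring
        · simp only
          linarith
      rwa [this]
  obtain ⟨k₂, hk₂, hk₂M, hk₂v⟩ := exists_contact_right hK hne hc hθ.1 htop hlev
  have hk₂0 := hT k₂ hk₂
  rw [hv] at hk₂v
  rcases hθ.1.eq_or_lt with hzero | hzero
  · refine hC.mem_of_arc (t₁ := -((k₂.2 - k₂.1) / 2)) (t₂ := (k₂.2 - k₂.1) / 2)
      (by linarith) (by linarith) ?_ ?_ hcs hcq
    · intro d hd1 hd2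
      rw [abs_neg, abs_of_nonneg (by linarith)] at hd2
      refine hend k₂ hk₂ hk₂M d ?_ hd2
      rw [hd1, ← hzero]
      ring
    · intro d hd1 hd2
      rw [abs_of_nonneg (by linarith)] at hd2
      exact hend k₂ hk₂ hk₂M d hd1 hd2
  · obtain ⟨k₁, hk₁, hk₁M, hk₁v⟩ := exists_contact_left hK hne hc hzero hθ.2 hlev
    have hk₁0 := hT k₁ hk₁
    rw [hv] at hk₁v
    refine hC.mem_of_arc (t₁ := (k₁.2 - k₁.1) / 2) (t₂ := (k₂.2 - k₂.1) / 2)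
      (by linarith) (by linarith) ?_ ?_ hcs hcq
    · intro d hd1 hd2
      rw [abs_of_nonneg (by linarith)] at hd2
      exact hend k₁ hk₁ hk₁M d hd1 hd2
    · intro d hd1 hd2
      rw [abs_of_nonneg (by linarith)] at hd2
      exact hend k₂ hk₂ hk₂M d hd1 hd2

/-- Raise the larger singular value until some `level θ` reaches its maximum over `K`; the given
point lies on a segment between two such boundary points. -/
lemma IsIsometricallyConvex.mem_of_mem_levelHull (hC : IsIsometricallyConvex C) (hK : IsCompact K)
    (hne : K.Nonempty) (hT : ∀ p ∈ K, 0 < p.1 ∧ p.1 ≤ p.2) (hKC : ∀ c, profile c ∈ K → c ∈ C)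
    {c : ℂ × ℂ} (hc : profile c ∈ levelHull K) : c ∈ C := by
  wlog h : ‖c.2‖ ≤ ‖c.1‖ generalizing c C
  · exact this (C := Prod.swap ⁻¹' C) (c := c.swap) hC.preimage_swap
      (fun d hd => hKC _ (by rwa [profile_swap])) (by rwa [profile_swap]) (le_of_not_ge h)
  have hB := height_pos hK hne hT
  have hq := norm_nonneg c.2
  set x := ‖c.1‖ - ‖c.2‖ with hx
  have hx0 : 0 ≤ x := sub_nonneg.2 h
  have hpc : profile c = (x, ‖c.1‖ + ‖c.2‖) := by simp [profile, ← hx, abs_of_nonneg hx0]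
  have hy : ‖c.1‖ + ‖c.2‖ ≤ height K := by
    have := snd_le_height_of_mem_levelHull hK hne hT (by rw [hpc]; exact hx0) hc
    rwa [hpc] at this
  have hcont : Continuous fun y => excess K (x, y) := (continuous_excess hK).comp (by fun_prop)
  obtain ⟨y, hyI, hy0⟩ : ∃ y ∈ Icc (‖c.1‖ + ‖c.2‖) (height K), excess K (x, y) = 0 := by
    refine intermediate_value_Icc hy hcont.continuousOn ⟨?_, ?_⟩
    · rw [← hpc]
      exact (mem_levelHull_iff hK hne hT).1 hc
    · refine le_trans ?_ (level_sub_maxLevel_le_excess hK _ ⟨hB.le, le_rfl⟩)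
      rw [maxLevel_height hK hne hT, level_eq_sq_add]
      simp
  have hmem : (x, y) ∈ levelHull K := (mem_levelHull_iff hK hne hT).2 hy0.le
  obtain ⟨θ, hθ, hθe⟩ := exists_excess_eq hK hne hT (x, y)
  have hbdry : ∀ d, profile d = (x, y) → d ∈ C := fun d hd =>
    hC.mem_of_level_eq hK hne hT hKC (hd ▸ hmem) hθ (by rw [hd]; linarith)
  have hy1 := hyI.1
  -- with `θ = -x` and `s = 0` the arc is the line along which the smaller singular value is `x`
  refine hC.mem_of_arc (θ := -x) (s := 0) (t₁ := -((y + x) / 2)) (t₂ := (y - x) / 2)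
    (t := ‖c.2‖) (by linarith) (by linarith) ?_ ?_ (by rw [hx]; ring) (abs_of_nonneg hq).symm
  · intro d hd1 hd2
    rw [abs_neg, abs_of_nonneg (by linarith)] at hd2
    have hd1' : ‖d.1‖ = (y - x) / 2 := by
      refine (sq_eq_sq₀ (norm_nonneg _) (by linarith)).1 ?_
      rw [hd1]
      ring
    refine hbdry d ?_
    simp only [profile]
    rw [hd1', hd2]
    ext
    · rw [abs_of_nonpos (by linarith)]
      ring
    · simp only
      ring
  · intro d hd1 hd2
    rw [abs_of_nonneg (by linarith)] at hd2
    have hd1' : ‖d.1‖ = (y + x) / 2 := by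
      refine (sq_eq_sq₀ (norm_nonneg _) (by linarith)).1 ?_
      rw [hd1]
      ring
    refine hbdry d ?_
    simp only [profile]
    rw [hd1', hd2]
    ext
    · rw [abs_of_nonneg (by linarith)]
      ring
    · simp only
      ring

theorem Rco_isotropicSet (hK : IsCompact K) (hne : K.Nonempty)
    (hT : ∀ p ∈ K, 0 < p.1 ∧ p.1 ≤ p.2) :
    Rco (isotropicSet K) = {ξ | (sigmaMin ξ, sigmaMax ξ) ∈ levelHull K} := by
  apply Subset.antisymm
  · exact Rco_subset (isLaminationConvex_levelHull hK hne hT) fun ξ hξ => subset_levelHull hK hξ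
  · intro ξ hξ
    have hC := (isLaminationConvex_Rco (isotropicSet K)).preimage_ofConf
    have hmem : (conf ξ, anti ξ) ∈ ofConf ⁻¹' Rco (isotropicSet K) := by
      refine hC.mem_of_mem_levelHull hK hne hT (fun c hc => subset_Rco _ ?_) ?_
      · change (sigmaMin (ofConf c), sigmaMax (ofConf c)) ∈ K
        rwa [sigma_pair_ofConf]
      · rw [← sigma_pair_eq]
        exact hξ
    simpa using hmem

end

/-! ### Shifting the set of singular values -/

/-- The set `K` moved by `(-δ, -δ)`. -/
def shift (K : Set (ℝ × ℝ)) (δ : ℝ) : Set (ℝ × ℝ) := (fun p => (p.1 - δ, p.2 - δ)) '' K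

lemma shiftedSet_eq (K : Set (ℝ × ℝ)) (δ : ℝ) : shiftedSet K δ = isotropicSet (shift K δ) := by
  ext ξ
  simp only [shiftedSet, isotropicSet, shift, mem_iUnion, exists_prop, mem_ofPred_eq, mem_image,
    eq_comm]

lemma level_shift (θ δ : ℝ) (p : ℝ × ℝ) :
    level θ (p.1 - δ, p.2 - δ) = level θ p - δ * (p.1 + p.2 - δ) := by
  simp only [level]
  ring

section

variable {K : Set (ℝ × ℝ)}

lemma isCompact_shift (hK : IsCompact K) (δ : ℝ) : IsCompact (shift K δ) :=
  hK.image (by fun_prop)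

lemma height_shift (hK : IsCompact K) (hne : K.Nonempty) (δ : ℝ) :
    height (shift K δ) = height K - δ := by
  apply le_antisymm
  · obtain ⟨-, ⟨k, hk, rfl⟩, h⟩ := exists_height_eq (isCompact_shift hK δ) (hne.image _)
    rw [h]
    linarith [le_height hK hk]
  · obtain ⟨k, hk, h⟩ := exists_height_eq hK hne
    rw [h]
    exact le_height (isCompact_shift hK δ) (mem_image_of_mem _ hk)

lemma isClosed_Rco_isotropicSet (hK : IsCompact K) (hne : K.Nonempty)
    (hT : ∀ p ∈ K, 0 < p.1 ∧ p.1 ≤ p.2) : IsClosed (Rco (isotropicSet K)) := by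
  have : Rco (isotropicSet K) = (fun ξ => excess K (sigmaMin ξ, sigmaMax ξ)) ⁻¹' Iic 0 := by
    rw [Rco_isotropicSet hK hne hT]
    ext ξ
    exact mem_levelHull_iff hK hne hT
  rw [this]
  exact isClosed_Iic.preimage ((continuous_excess hK).comp continuous_sigma_pair)

lemma sigma_pair_smul {t : ℝ} (ht : 0 ≤ t) (ξ : Mat2) :
    (sigmaMin (t • ξ), sigmaMax (t • ξ)) = (t * sigmaMin ξ, t * sigmaMax ξ) := by
  have h1 : conf (t • ξ) = t • conf ξ := by simpa using conf_comb t 0 ξ 0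
  have h2 : anti (t • ξ) = t • anti ξ := by simpa using anti_comb t 0 ξ 0
  rw [sigma_pair_eq, h1, h2, (sigma_eq ξ).1, (sigma_eq ξ).2]
  simp only [profile, norm_smul, Real.norm_of_nonneg ht]
  rw [← mul_sub, abs_mul, abs_of_nonneg ht, mul_add]

/-- The interior of the hull is cut out by the strict inequalities, because every `level θ` is
either strictly increasing along the ray through a matrix or vanishes there. -/
lemma mem_interior_Rco_isotropicSet_iff (hK : IsCompact K) (hne : K.Nonempty)
    (hT : ∀ p ∈ K, 0 < p.1 ∧ p.1 ≤ p.2) {ξ : Mat2} :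
    ξ ∈ interior (Rco (isotropicSet K)) ↔
      ∀ θ ∈ Icc 0 (height K), level θ (sigmaMin ξ, sigmaMax ξ) < maxLevel K θ := by
  rw [Rco_isotropicSet hK hne hT]
  constructor
  · intro hξ θ hθ
    have hcont : Tendsto (fun t : ℝ => t • ξ) (𝓝[>] 1) (𝓝 ξ) := by
      have : Tendsto (fun t : ℝ => t • ξ) (𝓝 1) (𝓝 ((1 : ℝ) • ξ)) :=
        Continuous.tendsto (by fun_prop) 1
      rw [one_smul] at this
      exact this.mono_left nhdsWithin_le_nhds
    obtain ⟨t, ht, ht1⟩ :=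
      ((hcont.eventually (mem_interior_iff_mem_nhds.1 hξ)).and self_mem_nhdsWithin).exists
    have ht1' : 1 < t := ht1
    have hlev := ht θ hθ
    rw [sigma_pair_smul (by linarith)] at hlev
    have hx := sigmaMin_nonneg ξ
    have hxy := sigmaMin_le_sigmaMax ξ
    have hM : 0 < maxLevel K θ := by
      obtain ⟨k, hk⟩ := hne
      refine lt_of_lt_of_le ?_ (level_le_maxLevel hK hk θ)
      have hk0 := hT k hk
      have h1 := mul_pos hk0.1 (hk0.1.trans_le hk0.2)
      have h2 := mul_nonneg hθ.1 (sub_nonneg.2 hk0.2)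
      unfold level
      linarith
    simp only [level] at hlev ⊢
    have h1 : 0 ≤ sigmaMin ξ * sigmaMax ξ := mul_nonneg hx (hx.trans hxy)
    have h2 : 0 ≤ θ * (sigmaMax ξ - sigmaMin ξ) := mul_nonneg hθ.1 (sub_nonneg.2 hxy)
    set u := sigmaMin ξ * sigmaMax ξ
    set v := θ * (sigmaMax ξ - sigmaMin ξ)
    have hlev' : t * (t * u) + t * v ≤ maxLevel K θ := by
      refine le_trans (le_of_eq ?_) hlev
      simp only [u, v]
      ring
    have hu : t * u ≤ t * (t * u) := le_mul_of_one_le_left (by positivity) ht1'.le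
    rcases (add_nonneg h1 h2).eq_or_lt with h0 | h0
    · linarith
    · nlinarith
  · intro h
    refine mem_interior.2 ⟨(fun ξ => excess K (sigmaMin ξ, sigmaMax ξ)) ⁻¹' Iio 0, ?_, ?_, ?_⟩
    · intro η hη
      exact (mem_levelHull_iff hK hne hT).2 (le_of_lt hη)
    · exact isOpen_Iio.preimage ((continuous_excess hK).comp continuous_sigma_pair)
    · exact excess_neg_of_forall_lt hK hne hT h

/-- Shifting lowers the maximum of every `level θ` strictly. For `θ` above the height of the
shifted set the strict inequality comes from the larger singular value being less than `θ`. -/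
lemma Rco_shift_subset_interior (hK : IsCompact K) (hne : K.Nonempty)
    {δ : ℝ} (hδ : 0 < δ) (hT : ∀ p ∈ K, δ < p.1 ∧ p.1 ≤ p.2) :
    Rco (isotropicSet (shift K δ)) ⊆ interior (Rco (isotropicSet K)) := by
  have hT0 : ∀ p ∈ K, 0 < p.1 ∧ p.1 ≤ p.2 := fun p hp => ⟨hδ.trans (hT p hp).1, (hT p hp).2⟩
  have hTδ : ∀ p ∈ shift K δ, 0 < p.1 ∧ p.1 ≤ p.2 := by
    rintro - ⟨p, hp, rfl⟩
    have := hT p hp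
    constructor <;> dsimp only <;> linarith
  have hKδ := isCompact_shift hK δ
  have hneδ : (shift K δ).Nonempty := hne.image _
  intro ξ hξ
  rw [Rco_isotropicSet hKδ hneδ hTδ] at hξ
  rw [mem_interior_Rco_isotropicSet_iff hK hne hT0]
  intro θ hθ
  rcases le_or_gt θ (height (shift K δ)) with hle | hlt
  · refine lt_of_le_of_lt (hξ θ ⟨hθ.1, hle⟩) ?_
    obtain ⟨-, ⟨k, hk, rfl⟩, h⟩ := exists_maxLevel_eq hKδ hneδ θ
    rw [h, level_shift]
    have hk0 := hT k hk
    have := mul_pos hδ (by linarith : 0 < k.1 + k.2 - δ)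
    linarith [level_le_maxLevel hK hk θ]
  · refine lt_of_lt_of_le ?_ (sq_le_maxLevel hK hne hT0 hθ)
    have h1 := snd_le_height_of_mem_levelHull hKδ hneδ hTδ (sigmaMin_nonneg ξ) hξ
    have h2 := height_pos hKδ hneδ hTδ
    have h3 := sigmaMin_nonneg ξ
    simp only at h1
    rw [level_eq_sq_add]
    have : (sigmaMax ξ - θ) * (sigmaMin ξ + θ) < 0 :=
      mul_neg_of_neg_of_pos (by linarith) (by linarith)
    simpa using this

lemma exists_mem_Rco_shift (hK : IsCompact K) (hne : K.Nonempty) {r : ℝ} (hr : 0 < r)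
    (hT : ∀ p ∈ K, r < p.1 ∧ p.1 ≤ p.2) {ξ : Mat2}
    (hξ : ξ ∈ interior (Rco (isotropicSet K))) :
    ∃ δ₀ > (0 : ℝ), ∀ δ ∈ Ioc 0 δ₀, ξ ∈ Rco (isotropicSet (shift K δ)) := by
  have hT0 : ∀ p ∈ K, 0 < p.1 ∧ p.1 ≤ p.2 := fun p hp => ⟨hr.trans (hT p hp).1, (hT p hp).2⟩
  rw [mem_interior_Rco_isotropicSet_iff hK hne hT0] at hξ
  have hneg := excess_neg_of_forall_lt hK hne hT0 hξ
  have hB := height_pos hK hne hT0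
  set e := -excess K (sigmaMin ξ, sigmaMax ξ) with he
  -- the shift lowers `level θ` on `K` by at most `2 δ height K`
  refine ⟨min r (e / (2 * height K)), lt_min hr (div_pos (by linarith) (by linarith)), ?_⟩
  intro δ hδ
  have hδr : δ ≤ r := hδ.2.trans (min_le_left _ _)
  have hδe : δ * (2 * height K) ≤ e :=
    (le_div_iff₀ (by linarith)).1 (hδ.2.trans (min_le_right _ _))
  have hTδ : ∀ p ∈ shift K δ, 0 < p.1 ∧ p.1 ≤ p.2 := by
    rintro - ⟨p, hp, rfl⟩
    have := hT p hp
    constructor <;> dsimp only <;> linarith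
  have hKδ := isCompact_shift hK δ
  rw [Rco_isotropicSet hKδ (hne.image _) hTδ]
  intro θ hθ
  rw [height_shift hK hne] at hθ
  obtain ⟨k, hk, h⟩ := exists_maxLevel_eq hK hne θ
  have h1 := level_sub_maxLevel_le_excess hK (sigmaMin ξ, sigmaMax ξ) (θ := θ)
    ⟨hθ.1, by linarith [hθ.2, hδ.1]⟩
  have h2 := level_le_maxLevel hKδ (mem_image_of_mem _ hk) θ
  rw [level_shift] at h2
  have hk0 := hT k hk
  have h3 := le_height hK hk
  have h4 : δ * (k.1 + k.2 - δ) ≤ δ * (2 * height K) :=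
    mul_le_mul_of_nonneg_left (by linarith [hδ.1]) hδ.1.le
  linarith

/-- A matrix is moved to another profile by lengthening the longer of its two parts. -/
lemma exists_profile_shift {δ : ℝ} (hδ : 0 ≤ δ) (c : ℂ × ℂ) :
    ∃ d : ℂ × ℂ, profile d = ((profile c).1 + δ, (profile c).2 + δ) ∧
      ‖c.1 - d.1‖ ^ 2 + ‖c.2 - d.2‖ ^ 2 = δ ^ 2 := by
  wlog h : ‖c.2‖ ≤ ‖c.1‖ generalizing c
  · obtain ⟨d, hd1, hd2⟩ := this c.swap (le_of_not_ge h)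
    refine ⟨d.swap, by rw [profile_swap, hd1, profile_swap], ?_⟩
    rw [← hd2, add_comm]
    rfl
  obtain ⟨e, he, hce⟩ := exists_unit_mul_eq (z := c.1) (c := (‖c.1‖ : ℂ)) (by simp)
  have hn : ‖e * ((‖c.1‖ + δ : ℝ) : ℂ)‖ = ‖c.1‖ + δ := by
    rw [norm_mul, he, one_mul, Complex.norm_real, Real.norm_of_nonneg (by positivity)]
  refine ⟨(e * ((‖c.1‖ + δ : ℝ) : ℂ), c.2), ?_, ?_⟩
  · simp only [profile]
    rw [hn, abs_of_nonneg (by linarith), abs_of_nonneg (by linarith)]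
    ext <;> simp only <;> ring
  · have : c.1 - e * ((‖c.1‖ + δ : ℝ) : ℂ) = -(e * (δ : ℂ)) := by
      nth_rw 1 [hce]
      push_cast
      ring
    simp only
    rw [this, norm_neg, norm_mul, he, Complex.norm_real, sub_self, norm_zero, one_mul,
      Real.norm_of_nonneg hδ]
    ring

lemma frobeniusDist_shiftedSet_le {δ ε : ℝ} (hδ : 0 ≤ δ) (hε : 2 * δ ≤ ε) {η : Mat2}
    (hη : η ∈ shiftedSet K δ) : frobeniusDist η (isotropicSet K) ≤ ENNReal.ofReal ε := by
  rw [shiftedSet_eq] at hη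
  obtain ⟨k, hk, hkη⟩ := hη
  rw [sigma_pair_eq] at hkη
  obtain ⟨d, hd1, hd2⟩ := exists_profile_shift hδ (conf η, anti η)
  have hd : ofConf d ∈ isotropicSet K := by
    change (sigmaMin (ofConf d), sigmaMax (ofConf d)) ∈ K
    rw [sigma_pair_ofConf, hd1, ← hkη]
    simpa using hk
  refine (iInf₂_le (ofConf d) hd).trans (ENNReal.ofReal_le_ofReal ?_)
  have hsum := sum_sq_eq_conf_anti (η - ofConf d)
  simp only [conf_sub, anti_sub, conf_ofConf, anti_ofConf, Matrix.sub_apply] at hsum hd2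
  rw [hsum, hd2]
  exact Real.sqrt_le_iff.2 ⟨by linarith, by nlinarith⟩

end

/-- A family indexed by the small positive numbers extends to one indexed by all of them. -/
lemma IsApproximatingFamily.extend {r : ℝ} (hr : 0 < r) {E KE : Set Mat2} {F KF : ℝ → Set Mat2}
    (h : IsApproximatingFamily (Ioc 0 r) E KE F KF) :
    IsApproximatingFamily (Ioi 0) E KE (fun δ => F (min δ r)) (fun δ => KF (min δ r)) := by
  have hmem : ∀ δ ∈ Ioi (0 : ℝ), min δ r ∈ Ioc 0 r := fun δ hδ =>
    ⟨lt_min hδ hr, min_le_right _ _⟩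
  refine ⟨fun δ hδ => hδ, self_mem_nhdsWithin, fun δ hδ => h.isClosed_left _ (hmem δ hδ),
    fun δ hδ => h.isClosed_right _ (hmem δ hδ), fun δ hδ => h.subset_hull _ (hmem δ hδ),
    fun δ hδ => h.subset_interior _ (hmem δ hδ), ?_, ?_⟩
  · intro ε hε
    obtain ⟨δ₀, h0, hδ₀⟩ := h.dist_le ε hε
    exact ⟨δ₀, h0, fun δ hδ => hδ₀ _ ⟨le_min hδ.1 hr.le, (min_le_left _ _).trans hδ.2⟩⟩
  · intro η hη
    obtain ⟨δ₀, h0, hδ₀⟩ := h.mem_of_interior η hη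
    exact ⟨δ₀, h0, fun δ hδ => hδ₀ _ ⟨lt_min hδ.1 hr, (min_le_left _ _).trans hδ.2⟩⟩

theorem mainTheorem3 (K : Set (ℝ × ℝ)) (hK : IsCompact K)
    (hT : ∀ p ∈ K, 0 ≤ p.1 ∧ p.1 ≤ p.2)
    (a₀ : ℝ) (ha₀ : IsLeast (Prod.fst '' K) a₀) (hpos : 0 < a₀) :
    HasApproximationProperty (isotropicSet K) (Rco (isotropicSet K)) ∧
      IsApproximatingFamily (Ioc 0 (a₀ / 2)) (isotropicSet K) (Rco (isotropicSet K))
        (fun δ => shiftedSet K δ) (fun δ => Rco (shiftedSet K δ)) := by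
  have hne : K.Nonempty := by
    obtain ⟨k, hk, -⟩ := ha₀.1
    exact ⟨k, hk⟩
  have hr : 0 < a₀ / 2 := by linarith
  have hTr : ∀ p ∈ K, a₀ / 2 < p.1 ∧ p.1 ≤ p.2 := fun p hp =>
    ⟨by linarith [ha₀.2 (mem_image_of_mem _ hp)], (hT p hp).2⟩
  have hfam : IsApproximatingFamily (Ioc 0 (a₀ / 2)) (isotropicSet K) (Rco (isotropicSet K))
      (fun δ => shiftedSet K δ) (fun δ => Rco (shiftedSet K δ)) := by
    refine ⟨fun δ hδ => hδ.1, Ioc_mem_nhdsGT hr, ?_, ?_, fun δ _ => subset_Rco _, ?_, ?_, ?_⟩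
    · intro δ _
      rw [shiftedSet_eq]
      exact (isCompact_shift hK δ).isClosed.preimage continuous_sigma_pair
    · intro δ hδ
      rw [shiftedSet_eq]
      refine isClosed_Rco_isotropicSet (isCompact_shift hK δ) (hne.image _) ?_
      rintro - ⟨p, hp, rfl⟩
      have := hTr p hp
      constructor <;> dsimp only <;> linarith [hδ.2]
    · intro δ hδ
      rw [shiftedSet_eq]
      exact Rco_shift_subset_interior hK hne hδ.1
        fun p hp => ⟨hδ.2.trans_lt (hTr p hp).1, (hTr p hp).2⟩
    · intro ε hε
      exact ⟨ε / 2, by linarith, fun δ hδ η hη =>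
        frobeniusDist_shiftedSet_le hδ.1 (by linarith [hδ.2]) hη⟩
    · intro η hη
      simp_rw [shiftedSet_eq]
      exact exists_mem_Rco_shift hK hne hr hTr hη
  exact ⟨⟨subset_Rco _, _, _, hfam.extend hr⟩, hfam⟩
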